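/- Let $n\ge 1$ be an integer and $T>0$. Let $H_i,H:[0,T]\times\mathbb R^n\times\mathbb R^n\to\mathbb R$, $\lambda_i,\lambda:[0,T]\times\mathbb R^n\to\mathbb R$ and $c_i,c:[0,T]\to[0,\infty)$, $i\in\mathbb N$. Measurability on $[0,T]$ is in the sense of Lebesgue, and $|\cdot|$ is the Euclidean norm. Put $$L(t,x,v)=\sup_{p\in\mathbb R^n}\{\langle v,p\rangle-H(t,x,p)\}\in[-\infty,+\infty],\qquad \operatorname{dom}L(t,x,\cdot)=\{v: L(t,x,v)\ne\pm\infty\},$$ and define $L_i$ from $H_i$ in the same way. Assume that $(H,\lambda,c)$, and likewise $(H_i,\lambda_i,c_i)$ for every $i\in\mathbb N$, satisfies the following conditions. - **(H1)** $H(\cdot,x,p)$ is measurable for all $x,p$. - **(H2)** $H(t,\cdot,\cdot)$ is continuous for every $t\in[0,T]$. - **(H3)** $H(t,x,\cdot)$ is convex for all $(t,x)$. - **(H4)** $c$ is measurable and $|H(t,x,p)-H(t,x,q)|\le c(t)(1+|x|)|p-q|$ for all $t,x,p,q$. - **(HLC)** For every $R>0$ there is a measurable $k_R:[0,T]\to[0,\infty)$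 with $|H(t,x,p)-H(t,y,p)|\le k_R(t)(1+|p|)|x-y|$ for all $t\in[0,T]$, $|x|,|y|\le R$, $p\in\mathbb R^n$. - **(BLC)** $\lambda(\cdot,x)$ is measurable for every $x$, $\lambda(t,\cdot)$ is continuous for every $t$, $L(t,x,v)\le\lambda(t,x)$ for all $(t,x)$ and all $v\in\operatorname{dom}L(t,x,\cdot)$, and for every $R>0$ there is a measurable $k_R:[0,T]\to[0,\infty)$ such that $\lambda(t,\cdot)$ is $k_R(t)$-Lipschitz on $\{|x|\le R\}$ for every $t\in[0,T]$. Identify $\mathbb R^n\times\mathbb R$ with $\mathbb R^{n+1}$, let $I\!B$ be the closed unit ball of $\mathbb R^{n+1}$, and let $I\!B(y,r)$ denote the closed ball of centre $y$ and radius $r$. For a nonempty convex compact set $K\subset\mathbb R^{n+1}$ let $$s_{n+1}(K)=(n+1)\int_{S^n}p\,\max_{z\in K}\langle p,z\rangle\,\mu(dp)$$ be its Steiner point, where $\mu$ is the surface measure of the unit sphere $S^n\subset\mathbb R^{n+1}$ normalised to $\mu(S^n)=1$. Set $$E_L(t,x)=\{(v,\eta)\in\mathbb R^n\times\mathbb R: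 L(t,x,v)\le\eta\},\qquad \omega(t,x)=|\lambda(t,x)|+|H(t,x,0)|+c(t)(1+|x|)+1,$$ $$\mathsf e(t,x,a)=s_{n+1}\Big(E_L(t,x)\cap I\!B\big(\omega(t,x)a,\;2\,d(\omega(t,x)a,E_L(t,x))\big)\Big),\qquad a\in I\!B,$$ where $d$ is the distance from a point to a set, and write $\mathsf e(t,x,a)=(f(t,x,a),l(t,x,a))$ with $f(t,x,a)\in\mathbb R^n$ and $l(t,x,a)\in\mathbb R$. Let $f_i,l_i$ be defined in the same way from $(H_i,\lambda_i,c_i)$. If, for every $t\in[0,T]$, $H_i(t,\cdot,\cdot)\to H(t,\cdot,\cdot)$ uniformly on compact subsets of $\mathbb R^n\times\mathbb R^n$, $\lambda_i(t,\cdot)\to\lambda(t,\cdot)$ uniformly on compact subsets of $\mathbb R^n$, and $c_i(t)\to c(t)$, then, for every $t\in[0,T]$, $f_i(t,\cdot,\cdot)\to f(t,\cdot,\cdot)$ and $l_i(t,\cdot,\cdot)\to l(t,\cdot,\cdot)$ uniformly on compact subsets of $\mathbb R^n\times I\!B$. -/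

import Mathlib

open Set Filter Topology MeasureTheory

noncomputable section

namespace HJRep

/-- The state space `ℝⁿ` with its Euclidean norm. -/
abbrev Rn (n : ℕ) : Type := EuclideanSpace ℝ (Fin n)

/-- The space `ℝⁿ × ℝ = ℝⁿ⁺¹` with its Euclidean norm `|(v, η)|² = |v|² + η²`. -/
abbrev Rn1 (n : ℕ) : Type := WithLp 2 (Rn n × ℝ)

/-- Lebesgue measurability of a real function on the interval `[0, T]`: preimages of Borel sets
are, inside `[0, T]`, Lebesgue measurable. -/
def LebesgueMeasurableOn (T : ℝ) (g : ℝ → ℝ) : Prop :=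
  NullMeasurable g (volume.restrict (Icc 0 T))

/-- A measurable map `[0, T] → [0, +∞)`. -/
structure IsMeasurableNonneg (T : ℝ) (k : ℝ → ℝ) : Prop where
  measurable : LebesgueMeasurableOn T k
  nonneg : ∀ t ∈ Icc 0 T, 0 ≤ k t

/-- Conditions (H1)-(H4) for a Hamiltonian `H` on `[0, T] × ℝⁿ × ℝⁿ`; `c` is the map
in the growth condition (H4). -/
structure SatisfiesH {n : ℕ} (T : ℝ) (H : ℝ → Rn n → Rn n → ℝ) (c : ℝ → ℝ) : Prop where
  h1 : ∀ x p, LebesgueMeasurableOn T (fun t => H t x p)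
  h2 : ∀ t ∈ Icc 0 T, Continuous (fun z : Rn n × Rn n => H t z.1 z.2)
  h3 : ∀ t ∈ Icc 0 T, ∀ x, ConvexOn ℝ univ (H t x)
  h4_map : IsMeasurableNonneg T c
  h4 : ∀ t ∈ Icc 0 T, ∀ x p q, |H t x p - H t x q| ≤ c t * (1 + ‖x‖) * ‖p - q‖

/-- Condition (HLC): Lipschitz continuity of the Hamiltonian in `x` on every ball. -/
def SatisfiesHLC {n : ℕ} (T : ℝ) (H : ℝ → Rn n → Rn n → ℝ) : Prop :=
  ∀ R : ℝ, 0 < R → ∃ k : ℝ → ℝ, IsMeasurableNonneg T k ∧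
    ∀ t ∈ Icc 0 T, ∀ x ∈ Metric.closedBall (0 : Rn n) R, ∀ y ∈ Metric.closedBall (0 : Rn n) R,
      ∀ p : Rn n, |H t x p - H t y p| ≤ k t * (1 + ‖p‖) * ‖x - y‖

/-- The Lagrangian `L(t, x, v) = sup_p (⟨v, p⟩ - H(t, x, p))`, with values in `[-∞, +∞]`. -/
def lagrangian {n : ℕ} (H : ℝ → Rn n → Rn n → ℝ) (t : ℝ) (x v : Rn n) : EReal :=
  ⨆ p : Rn n, ((inner ℝ v p - H t x p : ℝ) : EReal)

/-- The effective domain: the points where an extended-real-valued function is finite. -/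
def effDom {n : ℕ} (φ : Rn n → EReal) : Set (Rn n) :=
  {v | φ v ≠ ⊤ ∧ φ v ≠ ⊥}

/-- Condition (BLC) for a Lagrangian `L`, with the upper bound `lam`. -/
structure SatisfiesBLC {n : ℕ} (T : ℝ) (L : ℝ → Rn n → Rn n → EReal) (lam : ℝ → Rn n → ℝ) :
    Prop where
  measurable : ∀ x, LebesgueMeasurableOn T (fun t => lam t x)
  continuous : ∀ t ∈ Icc 0 T, Continuous (lam t)
  bound : ∀ t ∈ Icc 0 T, ∀ x, ∀ v ∈ effDom (L t x), L t x v ≤ (lam t x : EReal)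
  lipschitz : ∀ R : ℝ, 0 < R → ∃ k : ℝ → ℝ, IsMeasurableNonneg T k ∧
    ∀ t ∈ Icc 0 T, ∀ x ∈ Metric.closedBall (0 : Rn n) R, ∀ y ∈ Metric.closedBall (0 : Rn n) R,
      |lam t x - lam t y| ≤ k t * ‖x - y‖

/-- The epigraph `E_L(t, x) = {(v, η) | L(t, x, v) ≤ η}`, a subset of `ℝⁿ⁺¹`. -/
def epiSet {n : ℕ} (L : ℝ → Rn n → Rn n → EReal) (t : ℝ) (x : Rn n) : Set (Rn1 n) :=
  {z | L t x z.fst ≤ (z.snd : EReal)}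

/-- The map `P(y, K) = K ∩ B(y, 2 d(y, K))`. -/
def projBall {m : ℕ} (y : Rn1 m) (K : Set (Rn1 m)) : Set (Rn1 m) :=
  K ∩ Metric.closedBall y (2 * Metric.infDist y K)

/-- The support function `σ(K, p) = max_{x ∈ K} ⟨p, x⟩` of a nonempty compact set `K`. -/
def supportFn {n : ℕ} (K : Set (Rn1 n)) (p : Rn1 n) : ℝ :=
  sSup ((fun x => inner ℝ p x) '' K)

/-- The Steiner point `(n + 1) ∫ p σ(K, p) μ(dp)` of a nonempty convex compact set
`K ⊆ ℝⁿ⁺¹`, where `μ` is the surface measure of the unit sphere normalised to total mass one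
(hence the average integral). -/
def steinerPoint {n : ℕ} (K : Set (Rn1 n)) : Rn1 n :=
  ((n : ℝ) + 1) • ⨍ p : Metric.sphere (0 : Rn1 n) 1,
    supportFn K (p : Rn1 n) • (p : Rn1 n) ∂(volume : Measure (Rn1 n)).toSphere

/-- `ω(t, x) = |λ(t, x)| + |H(t, x, 0)| + c(t) (1 + |x|) + 1`. -/
def omega {n : ℕ} (H : ℝ → Rn n → Rn n → ℝ) (lam : ℝ → Rn n → ℝ) (c : ℝ → ℝ)
    (t : ℝ) (x : Rn n) : ℝ :=
  |lam t x| + |H t x 0| + c t * (1 + ‖x‖) + 1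

/-- The parametrisation `e(t, x, a)` of the epigraph of the Lagrangian: the Steiner point of
`P(ω(t, x) a, E_L(t, x))`. -/
def param {n : ℕ} (H : ℝ → Rn n → Rn n → ℝ) (lam : ℝ → Rn n → ℝ) (c : ℝ → ℝ)
    (t : ℝ) (x : Rn n) (a : Rn1 n) : Rn1 n :=
  steinerPoint (projBall (omega H lam c t x • a) (epiSet (lagrangian H) t x))

/-- The dynamics `f` of the representation: the `ℝⁿ`-component of `e`. -/
def repF {n : ℕ} (H : ℝ → Rn n → Rn n → ℝ) (lam : ℝ → Rn n → ℝ) (c : ℝ → ℝ)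
    (t : ℝ) (x : Rn n) (a : Rn1 n) : Rn n :=
  (param H lam c t x a).fst

/-- The running cost `l` of the representation: the last component of `e`. -/
def repL {n : ℕ} (H : ℝ → Rn n → Rn n → ℝ) (lam : ℝ → Rn n → ℝ) (c : ℝ → ℝ)
    (t : ℝ) (x : Rn n) (a : Rn1 n) : ℝ :=
  (param H lam c t x a).snd

/-- Uniform convergence of `g i` to `g₀` on every compact subset of `S`. -/
def TendstoUnifOnCompacts {X Y : Type*} [TopologicalSpace X] [UniformSpace Y]
    (g : ℕ → X → Y) (g₀ : X → Y) (S : Set X) : Prop :=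
  ∀ K : Set X, K ⊆ S → IsCompact K → TendstoUniformlyOn g g₀ atTop K

end HJRep

end

/-! The set `E_L(t, x)` is the epigraph of the convex conjugate of `H(t, x, ·)`, so the claim is
that conjugation, truncation by the ball and the Steiner point all pass to the limit.

Locally uniform convergence of convex functions gives Painlevé-Kuratowski convergence of the
conjugate epigraphs (`kuratowskiTendsto_epiConj`). Distances to these sets then converge, and so do
the support functions of the truncations (`tendsto_supportFn`): the radius is twice the distance, so
unless the distance is zero the open ball meets the convex set, and nothing is lost on the boundary
sphere. The Steiner point is an integral of the support function over the sphere, so dominated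
convergence suffices.

All this is done along an arbitrary countably generated filter, with the base point `x` and the
parameter `a` moving too. The result is continuous convergence, which on compact sets is uniform. -/

/-- A convex function dominating a continuous concave one is separated from it by an affine map. -/
theorem exists_affine_between {E : Type*} [NormedAddCommGroup E] [NormedSpace ℝ E] {f g : E → ℝ}
    (hf : ConvexOn ℝ univ f) (hg : ConcaveOn ℝ univ g) (hgc : Continuous g) (hgf : ∀ x, g x ≤ f x) :
    ∃ (l : StrongDual ℝ E) (b : ℝ), ∀ x, g x ≤ l x + b ∧ l x + b ≤ f x := by
  have hs : Convex ℝ {q : E × ℝ | q.2 < g q.1} := by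
    simpa using hg.convex_strict_hypograph
  have ht : Convex ℝ {q : E × ℝ | f q.1 ≤ q.2} := by
    simpa using hf.convex_epigraph
  have hso : IsOpen {q : E × ℝ | q.2 < g q.1} :=
    isOpen_lt continuous_snd (hgc.comp continuous_fst)
  have hd : Disjoint {q : E × ℝ | q.2 < g q.1} {q : E × ℝ | f q.1 ≤ q.2} := by
    refine Set.disjoint_left.2 fun q (h1 : q.2 < g q.1) (h2 : f q.1 ≤ q.2) => ?_
    linarith [hgf q.1]
  obtain ⟨F, u, hFs, hFt⟩ := geometric_hahn_banach_open hs hso ht hd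
  have hF : ∀ x r, F (x, r) = F (x, 0) + r * F (0, 1) := by
    intro x r
    have : ((x, r) : E × ℝ) = (x, 0) + r • (0, 1) := by simp
    rw [this, map_add, map_smul, smul_eq_mul]
  set β := F (0, 1) with hβ
  have h1 : F (0, g 0 - 1) < u := hFs _ (by simp)
  have h2 : u ≤ F (0, f 0) := hFt _ (by simp)
  rw [hF] at h1 h2
  -- The hyperplane separates two points above `0`, so it is not vertical and is the graph of an
  -- affine map.
  have hβpos : 0 < β := by nlinarith [hgf 0]
  refine ⟨(-β⁻¹) • F.comp (ContinuousLinearMap.inl ℝ E ℝ), β⁻¹ * u, fun x => ?_⟩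
  have hval : ((-β⁻¹) • F.comp (ContinuousLinearMap.inl ℝ E ℝ)) x + β⁻¹ * u
      = (u - F (x, 0)) / β := by
    simp; ring
  rw [hval]
  constructor
  · refine le_of_forall_lt fun r hr => ?_
    have := hFs (x, r) hr
    rw [hF] at this
    rw [lt_div_iff₀ hβpos]; linarith
  · have := hFt (x, f x) (by simp)
    rw [hF] at this
    rw [div_le_iff₀ hβpos]; linarith

/-! ### Epigraphs of conjugates and their stability -/

namespace HJRep

variable {n : ℕ}

/-- The epigraph of the convex conjugate of `h`. -/
def epiConj (h : Rn n → ℝ) : Set (Rn1 n) :=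
  {z | ∀ p, inner ℝ z.fst p - h p ≤ z.snd}

theorem epiSet_lagrangian (H : ℝ → Rn n → Rn n → ℝ) (t : ℝ) (x : Rn n) :
    epiSet (lagrangian H) t x = epiConj (H t x) := by
  ext z
  simp only [epiSet, lagrangian, epiConj, mem_ofPred_eq, iSup_le_iff, EReal.coe_le_coe_iff]

theorem continuous_fst_Rn1 : Continuous fun z : Rn1 n => z.fst :=
  WithLp.continuous_fst 2 _ _

theorem continuous_snd_Rn1 : Continuous fun z : Rn1 n => z.snd :=
  WithLp.continuous_snd 2 _ _

theorem isClosed_epiConj (h : Rn n → ℝ) : IsClosed (epiConj h) := by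
  simp only [epiConj, ofPred_forall]
  refine isClosed_iInter fun p => isClosed_le ?_ continuous_snd_Rn1
  exact (continuous_fst_Rn1.inner continuous_const).sub continuous_const

theorem convex_epiConj (h : Rn n → ℝ) : Convex ℝ (epiConj h) := by
  intro z hz w hw a b ha hb hab p
  have h1 := mul_le_mul_of_nonneg_left (hz p) ha
  have h2 := mul_le_mul_of_nonneg_left (hw p) hb
  have h3 : h p = a * h p + b * h p := by rw [← add_mul, hab, one_mul]
  simp only [WithLp.add_fst, WithLp.smul_fst, WithLp.add_snd, WithLp.smul_snd, smul_eq_mul,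
    inner_add_left, real_inner_smul_left]
  linarith

theorem epiConj_nonempty {h : Rn n → ℝ} (hc : ConvexOn ℝ univ h) (hcont : Continuous h) :
    (epiConj h).Nonempty := by
  have hlt : h 0 - 1 < h 0 := by linarith
  obtain ⟨l, c, hl, -⟩ := hc.exists_affine_le_of_lt (𝕜 := ℝ) (mem_univ (0 : Rn n)) hlt
    isClosed_univ (hcont.lowerSemicontinuous.lowerSemicontinuousOn _)
  refine ⟨WithLp.toLp 2 ((InnerProductSpace.toDual ℝ (Rn n)).symm l, -c), fun p => ?_⟩
  have := hl ⟨p, mem_univ p⟩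
  simp at this ⊢
  linarith

/-- A vector has norm at most `ε` if its inner products grow at most like `ε ‖·‖` plus a constant. -/
theorem norm_le_of_inner_le {E : Type*} [NormedAddCommGroup E] [InnerProductSpace ℝ E] {u : E}
    {ε C : ℝ} (hε : 0 ≤ ε) (h : ∀ p, inner ℝ u p ≤ C + ε * ‖p‖) : ‖u‖ ≤ ε := by
  by_contra! hu
  have hpos : 0 < ‖u‖ * (‖u‖ - ε) := mul_pos (hε.trans_lt hu) (by linarith)
  set s := (|C| + 1) / (‖u‖ * (‖u‖ - ε)) with hs
  have hs0 : 0 ≤ s := by positivity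
  have := h (s • u)
  rw [real_inner_smul_right, real_inner_self_eq_norm_sq, norm_smul, Real.norm_of_nonneg hs0] at this
  have h2 : s * (‖u‖ * (‖u‖ - ε)) = |C| + 1 := div_mul_cancel₀ _ hpos.ne'
  nlinarith [le_abs_self C]

/-- The hypothesis gives `h` a concave minorant. An affine map between the two has slope within `ε`
of `z.fst` and value at least `-z.snd - ε` at `0`, so its slope paired with `z.snd + ε` lies in the
epigraph. -/
theorem exists_mem_epiConj_near {h : Rn n → ℝ} (hc : ConvexOn ℝ univ h) {z : Rn1 n} {ε : ℝ}
    (hε : 0 ≤ ε) (hz : ∀ p, inner ℝ z.fst p - z.snd - ε - ε * ‖p‖ ≤ h p) :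
    ∃ w ∈ epiConj h, dist w z ≤ 2 * ε := by
  have hconc : ConcaveOn ℝ univ fun p : Rn n => inner ℝ z.fst p - z.snd - ε - ε * ‖p‖ := by
    have h1 : ConvexOn ℝ univ fun p : Rn n => ε * ‖p‖ := by
      simpa using (convexOn_norm (E := Rn n) convex_univ).smul hε
    have h2 : ConcaveOn ℝ univ fun p : Rn n => inner ℝ z.fst p :=
      (innerSL ℝ z.fst).toLinearMap.concaveOn convex_univ
    have h3 := (h2.add_const (-z.snd - ε)).sub h1
    refine h3.congr fun p _ => ?_
    simp; ring
  obtain ⟨l, b, hl⟩ := exists_affine_between hc hconc (by fun_prop) hz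
  set v := (InnerProductSpace.toDual ℝ (Rn n)).symm l with hv
  have hvl : ∀ p, inner ℝ v p = l p := fun p => by simp [hv]
  have hnorm : ‖z.fst - v‖ ≤ ε := by
    refine norm_le_of_inner_le (C := b + z.snd + ε) hε fun p => ?_
    rw [inner_sub_left, hvl]
    linarith [(hl p).1]
  refine ⟨WithLp.toLp 2 (v, z.snd + ε), fun p => ?_, ?_⟩
  · have h0 := (hl 0).1
    simp at h0
    have := (hl p).2
    simp only [WithLp.toLp_fst, WithLp.toLp_snd, hvl]
    linarith
  · rw [dist_comm, dist_eq_norm, WithLp.prod_norm_eq_of_L2]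
    refine Real.sqrt_le_iff.2 ⟨by positivity, ?_⟩
    simp only [WithLp.sub_fst, WithLp.sub_snd, WithLp.toLp_fst, WithLp.toLp_snd]
    have : ‖z.snd - (z.snd + ε)‖ = ε := by simp [abs_of_nonneg hε]
    rw [this]
    nlinarith [norm_nonneg (z.fst - v)]

/-- A convex function close on a large ball to one with an affine minorant almost has the same
minorant on the whole space. -/
theorem affine_le_of_close_on_ball {h h' : Rn n → ℝ} (hc : ConvexOn ℝ univ h') {z : Rn1 n}
    (hz : z ∈ epiConj h) {ε R : ℝ} (hε : 0 < ε)
    (hR : (|z.snd| + 2 * ε + |h 0|) / ε + 1 ≤ R)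
    (hclose : ∀ p, ‖p‖ ≤ R → |h' p - h p| ≤ ε) (p : Rn n) :
    inner ℝ z.fst p - z.snd - ε - ε * ‖p‖ ≤ h' p := by
  have hq : 0 ≤ (|z.snd| + 2 * ε + |h 0|) / ε := by positivity
  have hR0 : 0 < R := by linarith
  have hRε : |z.snd| + 2 * ε + |h 0| ≤ ε * R := by
    have : (|z.snd| + 2 * ε + |h 0|) / ε ≤ R := by linarith
    rw [div_le_iff₀ hε] at this
    linarith
  rcases le_or_gt ‖p‖ R with hp | hp
  · have h1 := abs_le.1 (hclose p hp)
    have h2 := hz p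
    have : 0 ≤ ε * ‖p‖ := by positivity
    linarith
  -- Outside the ball, use convexity on `[0, p]` at the point `s • p` of norm `R`. The errors there
  -- and at `0` add up to at most `|z.snd| + 2 * ε + |h 0| ≤ ε * R = s * (ε * ‖p‖)`.
  · have hpp : 0 < ‖p‖ := hR0.trans hp
    set s := R / ‖p‖ with hs
    have hs0 : 0 < s := by positivity
    have hs1 : s ≤ 1 := (div_le_one hpp).2 hp.le
    have hsp : s * ‖p‖ = R := by rw [hs]; field_simp
    have hnorm : ‖s • p‖ ≤ R := by rw [norm_smul, Real.norm_of_nonneg hs0.le, hsp]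
    have hconv := hc.2 (mem_univ p) (mem_univ 0) hs0.le (sub_nonneg.2 hs1) (by ring)
    simp only [smul_zero, add_zero, smul_eq_mul] at hconv
    have h1 := abs_le.1 (hclose _ hnorm)
    have h2 := hz (s • p)
    rw [real_inner_smul_right] at h2
    have h3 := abs_le.1 (hclose 0 (by simpa using hR0.le))
    have h4 := hz 0
    simp only [inner_zero_right] at h4
    have key : s * (inner ℝ z.fst p - z.snd - ε - ε * ‖p‖) ≤ s * h' p := by
      have e1 : s * (inner ℝ z.fst p - z.snd - ε - ε * ‖p‖)
        = s * inner ℝ z.fst p - s * (z.snd + ε) - ε * R := by rw [← hsp]; ring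
      rw [e1]
      have e2 : (1 - s) * h' 0 ≤ |h 0| + ε - s * h' 0 := by
        nlinarith [le_abs_self (h 0)]
      have e3 : 0 ≤ s * (h' 0 + z.snd + ε) := mul_nonneg hs0.le (by linarith)
      nlinarith [le_abs_self z.snd]
    exact le_of_mul_le_mul_left key hs0

/-! ### Set convergence and distances -/

/-- Painlevé-Kuratowski convergence of sets along a filter. -/
structure KuratowskiTendsto {ι V : Type*} [PseudoMetricSpace V] (A : ι → Set V) (l : Filter ι)
    (A₀ : Set V) : Prop where
  exists_near : ∀ z ∈ A₀, ∀ ε > 0, ∀ᶠ k in l, ∃ w ∈ A k, dist w z < ε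
  mem_of_tendsto : ∀ U : Ultrafilter ι, ↑U ≤ l → ∀ (z : ι → V) (z₀ : V), (∀ k, z k ∈ A k) →
    Tendsto z U (𝓝 z₀) → z₀ ∈ A₀

/-- An eventually bounded family in a proper space converges along every ultrafilter. -/
theorem exists_tendsto_ultrafilter {ι V : Type*} [PseudoMetricSpace V] [ProperSpace V]
    (U : Ultrafilter ι) {z : ι → V} {y : V} {R : ℝ} (h : ∀ᶠ k in U, dist (z k) y ≤ R) :
    ∃ z₀, Tendsto z U (𝓝 z₀) := by
  obtain ⟨z₀, -, hz₀⟩ := (isCompact_closedBall y R).ultrafilter_le_nhds' (U.map z) h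
  exact ⟨z₀, hz₀⟩

section

variable {ι : Type*} {l : Filter ι} {A : ι → Set (Rn1 n)} {A₀ : Set (Rn1 n)} {y : ι → Rn1 n}
  {y₀ : Rn1 n}

theorem KuratowskiTendsto.eventually_infDist_lt {V : Type*} [PseudoMetricSpace V]
    {A : ι → Set V} {A₀ : Set V} {y : ι → V} {y₀ : V} (hA : KuratowskiTendsto A l A₀)
    (h₀ : A₀.Nonempty) (hy : Tendsto y l (𝓝 y₀)) {r : ℝ} (hr : Metric.infDist y₀ A₀ < r) :
    ∀ᶠ k in l, Metric.infDist (y k) (A k) < r := by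
  obtain ⟨w, hw, hwr⟩ := (Metric.infDist_lt_iff h₀).1 hr
  have hε : 0 < (r - dist y₀ w) / 2 := by linarith
  filter_upwards [hA.exists_near w hw _ hε, Metric.tendsto_nhds.1 hy _ hε] with k ⟨x, hx, hxw⟩ hk
  have h1 := Metric.infDist_le_dist_of_mem (x := y k) hx
  have h2 := dist_triangle4 (y k) y₀ w x
  rw [dist_comm w x] at h2
  linarith

/-- Nearest points stay bounded, and their limit along an ultrafilter lies in `A₀`; this bounds the
limit distance from below, and `eventually_infDist_lt` bounds it from above. -/
theorem KuratowskiTendsto.tendsto_infDist {V : Type*} [PseudoMetricSpace V] [ProperSpace V]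
    {A : ι → Set V} {A₀ : Set V} {y : ι → V} {y₀ : V} (hA : KuratowskiTendsto A l A₀)
    (h₀ : A₀.Nonempty) (hcl : ∀ k, IsClosed (A k)) (hne : ∀ k, (A k).Nonempty)
    (hy : Tendsto y l (𝓝 y₀)) :
    Tendsto (fun k => Metric.infDist (y k) (A k)) l (𝓝 (Metric.infDist y₀ A₀)) := by
  refine (tendsto_iff_ultrafilter _ _ _).2 fun U hU => ?_
  choose z hzA hz using fun k => (hcl k).exists_infDist_eq_dist (hne k) (y k)
  have hy' := hy.mono_left hU
  obtain ⟨z₀, hz₀⟩ : ∃ z₀, Tendsto z U (𝓝 z₀) := by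
    refine exists_tendsto_ultrafilter U (y := y₀) (R := Metric.infDist y₀ A₀ + 1 + 1) ?_
    filter_upwards [hU (hA.eventually_infDist_lt h₀ hy (lt_add_one _)),
      Metric.tendsto_nhds.1 hy' 1 one_pos] with k h1 h2
    have := dist_triangle (z k) (y k) y₀
    rw [hz, dist_comm] at h1
    linarith
  have hlim : Tendsto (fun k => Metric.infDist (y k) (A k)) U (𝓝 (dist y₀ z₀)) := by
    simp only [hz]
    exact hy'.dist hz₀
  have hz₀A := hA.mem_of_tendsto U hU z z₀ hzA hz₀
  have hle : dist y₀ z₀ ≤ Metric.infDist y₀ A₀ := by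
    refine le_of_forall_gt_imp_ge_of_dense fun r hr => ?_
    refine le_of_tendsto hlim ?_
    filter_upwards [hU (hA.eventually_infDist_lt h₀ hy hr)] with k hk using hk.le
  rwa [hle.antisymm (Metric.infDist_le_dist_of_mem hz₀A)] at hlim

/-! ### Truncated sets, support functions and Steiner points -/

theorem isCompact_projBall {K : Set (Rn1 n)} (hK : IsClosed K) (y : Rn1 n) :
    IsCompact (projBall y K) :=
  (isCompact_closedBall _ _).inter_left hK

theorem projBall_nonempty {K : Set (Rn1 n)} (hK : IsClosed K) (hne : K.Nonempty) (y : Rn1 n) :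
    (projBall y K).Nonempty := by
  obtain ⟨z, hz, hd⟩ := hK.exists_infDist_eq_dist hne y
  refine ⟨z, hz, ?_⟩
  rw [Metric.mem_closedBall, dist_comm, ← hd]
  linarith [Metric.infDist_nonneg (x := y) (s := K)]

theorem exists_supportFn_eq {K : Set (Rn1 n)} (hK : IsCompact K) (hne : K.Nonempty) (p : Rn1 n) :
    ∃ z ∈ K, supportFn K p = inner ℝ p z :=
  hK.exists_sSup_image_eq hne (by fun_prop)

theorem le_supportFn {K : Set (Rn1 n)} (hK : IsCompact K) (p : Rn1 n) {z : Rn1 n} (hz : z ∈ K) :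
    inner ℝ p z ≤ supportFn K p :=
  le_csSup (hK.bddAbove_image (by fun_prop)) (mem_image_of_mem _ hz)

theorem abs_supportFn_le {K : Set (Rn1 n)} (hK : IsCompact K) (hne : K.Nonempty) (p : Rn1 n)
    {R : ℝ} (hR : ∀ z ∈ K, ‖z‖ ≤ R) : |supportFn K p| ≤ ‖p‖ * R := by
  obtain ⟨z, hz, h⟩ := exists_supportFn_eq hK hne p
  rw [h]
  exact (abs_real_inner_le_norm p z).trans (mul_le_mul_of_nonneg_left (hR z hz) (norm_nonneg _))

theorem continuous_supportFn {K : Set (Rn1 n)} (hK : IsCompact K) (hne : K.Nonempty) :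
    Continuous (supportFn K) := by
  obtain ⟨R, hR⟩ := hK.isBounded.exists_norm_le
  refine (LipschitzWith.of_le_add_mul R.toNNReal fun p q => ?_).continuous
  obtain ⟨z, hz, h⟩ := exists_supportFn_eq hK hne p
  have h1 := le_supportFn hK q hz
  have h2 : inner ℝ (p - q) z ≤ ‖p - q‖ * ‖z‖ := real_inner_le_norm _ _
  have h3 : ‖p - q‖ * ‖z‖ ≤ ‖p - q‖ * R := mul_le_mul_of_nonneg_left (hR z hz) (norm_nonneg _)
  rw [inner_sub_left] at h2
  rw [dist_eq_norm, h, Real.coe_toNNReal _ ((norm_nonneg z).trans (hR z hz)), mul_comm R]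
  linarith

/-- The slack `3` is `2` from doubling a distance known up to `1`, plus `1` from the moving centre.
-/
theorem KuratowskiTendsto.eventually_norm_le (hA : KuratowskiTendsto A l A₀)
    (h₀ : A₀.Nonempty) (hy : Tendsto y l (𝓝 y₀)) :
    ∀ᶠ k in l, ∀ z ∈ projBall (y k) (A k), ‖z‖ ≤ ‖y₀‖ + 2 * Metric.infDist y₀ A₀ + 3 := by
  filter_upwards [hA.eventually_infDist_lt h₀ hy (lt_add_one _),
    Metric.tendsto_nhds.1 hy 1 one_pos] with k h1 h2 z hz
  have h3 := Metric.mem_closedBall.1 hz.2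
  have h4 := dist_triangle4 z (y k) y₀ 0
  rw [dist_zero_right, dist_zero_right] at h4
  linarith

/-- If the distance is positive, a linear upper bound on the part of a closed convex set in the open
ball of radius twice the distance extends to the part in the closed ball. -/
theorem inner_le_of_forall_dist_lt (hc : Convex ℝ A₀) (hcl : IsClosed A₀) {p x : Rn1 n} {s : ℝ}
    (hx : x ∈ projBall y₀ A₀) (hd : 0 < Metric.infDist y₀ A₀)
    (h : ∀ w ∈ A₀, dist w y₀ < 2 * Metric.infDist y₀ A₀ → inner ℝ p w ≤ s) :
    inner ℝ p x ≤ s := by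
  obtain ⟨w, hw, hwd⟩ := hcl.exists_infDist_eq_dist ⟨x, hx.1⟩ y₀
  have hx2 := Metric.mem_closedBall.1 hx.2
  -- Moving `x` towards the nearest point `w` by `θ` brings the distance to `y₀` down to at most `2
  -- - θ` times the minimal one.
  have hlim : Tendsto (fun θ : ℝ => inner ℝ p ((1 - θ) • x + θ • w)) (𝓝[>] 0) (𝓝 (inner ℝ p x)) := by
    have hcont : Continuous fun θ : ℝ => inner ℝ p ((1 - θ) • x + θ • w) := by fun_prop
    have := hcont.tendsto 0
    simp only [sub_zero, one_smul, zero_smul, add_zero] at this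
    exact this.mono_left nhdsWithin_le_nhds
  refine le_of_tendsto hlim ?_
  filter_upwards [Ioo_mem_nhdsGT (zero_lt_one (α := ℝ))] with θ hθ
  refine h _ (hc hx.1 hw (by linarith [hθ.2]) hθ.1.le (by ring)) ?_
  have e : (1 - θ) • x + θ • w - y₀ = (1 - θ) • (x - y₀) + θ • (w - y₀) := by module
  rw [dist_eq_norm] at hx2 ⊢
  rw [e]
  have h1 := norm_add_le ((1 - θ) • (x - y₀)) (θ • (w - y₀))
  rw [norm_smul, norm_smul, Real.norm_of_nonneg hθ.1.le,
    Real.norm_of_nonneg (by linarith [hθ.2] : 0 ≤ 1 - θ), ← dist_eq_norm w, dist_comm w, ← hwd] at h1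
  have h2 : (1 - θ) * ‖x - y₀‖ ≤ (1 - θ) * (2 * Metric.infDist y₀ A₀) :=
    mul_le_mul_of_nonneg_left hx2 (by linarith [hθ.2])
  nlinarith [hθ.1]

/-- Maximisers accumulate at a point `z₀` of the limit truncation; it remains to see that `z₀` is a
maximiser there. -/
theorem KuratowskiTendsto.tendsto_supportFn (hA : KuratowskiTendsto A l A₀)
    (hc₀ : Convex ℝ A₀) (hcl₀ : IsClosed A₀) (h₀ : A₀.Nonempty) (hcl : ∀ k, IsClosed (A k))
    (hne : ∀ k, (A k).Nonempty) (hy : Tendsto y l (𝓝 y₀)) (p : Rn1 n) :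
    Tendsto (fun k => supportFn (projBall (y k) (A k)) p) l
      (𝓝 (supportFn (projBall y₀ A₀) p)) := by
  refine (tendsto_iff_ultrafilter _ _ _).2 fun U hU => ?_
  have hK := fun k => isCompact_projBall (hcl k) (y k)
  choose z hzA hz using fun k => exists_supportFn_eq (hK k) (projBall_nonempty (hcl k) (hne k) (y k)) p
  have hy' := hy.mono_left hU
  have hd := (hA.tendsto_infDist h₀ hcl hne hy).mono_left hU
  obtain ⟨z₀, hz₀⟩ : ∃ z₀, Tendsto z U (𝓝 z₀) := by
    refine exists_tendsto_ultrafilter U (y := 0) ?_ (R := ‖y₀‖ + 2 * Metric.infDist y₀ A₀ + 3)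
    filter_upwards [hU (hA.eventually_norm_le h₀ hy)] with k hk
    rw [dist_zero_right]
    exact hk _ (hzA k)
  have hlim : Tendsto (fun k => supportFn (projBall (y k) (A k)) p) U (𝓝 (inner ℝ p z₀)) := by
    simp only [hz]
    exact tendsto_const_nhds.inner hz₀
  have hz₀A : z₀ ∈ projBall y₀ A₀ := by
    refine ⟨hA.mem_of_tendsto U hU z z₀ (fun k => (hzA k).1) hz₀, ?_⟩
    exact le_of_tendsto_of_tendsto' (hz₀.dist hy') (hd.const_mul 2) fun k => (hzA k).2
  have hK₀ := isCompact_projBall hcl₀ y₀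
  suffices h : supportFn (projBall y₀ A₀) p ≤ inner ℝ p z₀ by
    rwa [h.antisymm (le_supportFn hK₀ p hz₀A)]
  obtain ⟨x, hx, hxs⟩ := exists_supportFn_eq hK₀ (projBall_nonempty hcl₀ h₀ y₀) p
  rw [hxs]
  -- At distance zero the truncation is the single point `y₀`. Otherwise only points `w` of the open
  -- ball need testing, and their approximants in `A k` eventually lie in the truncations.
  rcases Metric.infDist_nonneg.eq_or_lt' (a := Metric.infDist y₀ A₀) with h0 | hpos
  · have e1 := hx.2
    have e2 := hz₀A.2
    rw [h0, mul_zero, Metric.closedBall_zero, mem_singleton_iff] at e1 e2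
    rw [e1, e2]
  refine inner_le_of_forall_dist_lt hc₀ hcl₀ hx hpos fun w hw hwd => ?_
  refine le_of_forall_pos_sub_le fun δ hδ => ?_
  obtain ⟨r, hr1, hr2⟩ := exists_between hwd
  -- The first bound costs at most `δ` in the inner product; the second keeps the approximant within
  -- `r` of `y k`, after errors `ε` in both `w` and `y₀`.
  set ε := min (δ / (‖p‖ + 1)) ((r - dist w y₀) / 2) with hε
  have hε0 : 0 < ε := by
    refine lt_min (by positivity) (by linarith)
  have hεr : ε ≤ (r - dist w y₀) / 2 := min_le_right _ _
  have hεp : ‖p‖ * ε ≤ δ := by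
    have : ε ≤ δ / (‖p‖ + 1) := min_le_left _ _
    rw [le_div_iff₀ (by positivity)] at this
    nlinarith
  refine ge_of_tendsto hlim ?_
  filter_upwards [hU (hA.exists_near w hw ε hε0), Metric.tendsto_nhds.1 hy' ε hε0,
    (hd.const_mul 2).eventually_const_lt hr2] with k ⟨v, hv, hvw⟩ h1 h2
  have hvk : v ∈ projBall (y k) (A k) := by
    refine ⟨hv, ?_⟩
    have := dist_triangle4 v w y₀ (y k)
    rw [dist_comm y₀] at this
    rw [Metric.mem_closedBall]
    linarith
  have h3 := le_supportFn (hK k) p hvk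
  have h4 : inner ℝ p (w - v) ≤ ‖p‖ * ‖w - v‖ := real_inner_le_norm _ _
  rw [inner_sub_right, ← dist_eq_norm, dist_comm] at h4
  have h5 : ‖p‖ * dist v w ≤ ‖p‖ * ε := mul_le_mul_of_nonneg_left hvw.le (norm_nonneg _)
  linarith

theorem KuratowskiTendsto.tendsto_steinerPoint [l.IsCountablyGenerated]
    (hA : KuratowskiTendsto A l A₀)
    (hc₀ : Convex ℝ A₀) (hcl₀ : IsClosed A₀) (h₀ : A₀.Nonempty) (hcl : ∀ k, IsClosed (A k))
    (hne : ∀ k, (A k).Nonempty) (hy : Tendsto y l (𝓝 y₀)) :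
    Tendsto (fun k => steinerPoint (projBall (y k) (A k))) l
      (𝓝 (steinerPoint (projBall y₀ A₀))) := by
  simp only [steinerPoint, average_eq]
  refine ((tendsto_integral_filter_of_dominated_convergence
    (fun _ => ‖y₀‖ + 2 * Metric.infDist y₀ A₀ + 3) ?_ ?_ (integrable_const _) ?_).const_smul
      _).const_smul _
  · refine Eventually.of_forall fun k => Continuous.aestronglyMeasurable ?_
    have := continuous_supportFn (isCompact_projBall (hcl k) (y k))
      (projBall_nonempty (hcl k) (hne k) (y k))
    fun_prop
  · filter_upwards [hA.eventually_norm_le h₀ hy] with k hk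
    refine ae_of_all _ fun p => ?_
    have h1 := abs_supportFn_le (isCompact_projBall (hcl k) (y k))
      (projBall_nonempty (hcl k) (hne k) (y k)) p hk
    have h2 : ‖(p : Rn1 n)‖ = 1 := norm_eq_of_mem_sphere p
    rw [h2, one_mul] at h1
    rwa [norm_smul, h2, mul_one]
  · exact ae_of_all _ fun p =>
      (hA.tendsto_supportFn hc₀ hcl₀ h₀ hcl hne hy (p : Rn1 n)).smul_const _

end

/-! ### Convergence of the parametrisation -/

/-- Conjugation turns locally uniform convergence of convex functions into convergence of
epigraphs. -/
theorem kuratowskiTendsto_epiConj {ι : Type*} {l : Filter ι} {h : ι → Rn n → ℝ} {h₀ : Rn n → ℝ}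
    (hc : ∀ k, ConvexOn ℝ univ (h k))
    (hlim : ∀ R, ∀ ε > 0, ∀ᶠ k in l, ∀ p, ‖p‖ ≤ R → |h k p - h₀ p| ≤ ε) :
    KuratowskiTendsto (fun k => epiConj (h k)) l (epiConj h₀) where
  exists_near z hz ε hε := by
    have hε' : 0 < ε / 4 := by positivity
    filter_upwards [hlim ((|z.snd| + 2 * (ε / 4) + |h₀ 0|) / (ε / 4) + 1) (ε / 4) hε'] with k hk
    obtain ⟨w, hw, hd⟩ := exists_mem_epiConj_near (hc k) hε'.le
      (affine_le_of_close_on_ball (hc k) hz hε' le_rfl hk)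
    exact ⟨w, hw, by linarith⟩
  mem_of_tendsto U hU z z₀ hz hz₀ p := by
    have hp : Tendsto (fun k => h k p) U (𝓝 (h₀ p)) := by
      refine Metric.tendsto_nhds.2 fun ε hε => ?_
      filter_upwards [hU (hlim ‖p‖ (ε / 2) (by positivity))] with k hk
      rw [Real.dist_eq]
      linarith [hk p le_rfl]
    have h1 := (continuous_fst_Rn1.tendsto z₀).comp hz₀
    have h2 := (continuous_snd_Rn1.tendsto z₀).comp hz₀
    exact le_of_tendsto_of_tendsto' ((h1.inner tendsto_const_nhds).sub hp) h2 fun k => hz k p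

/-- The general index serves twice: constant families give continuity of the limit, and pairs
(index, point) give continuous convergence. -/
theorem tendsto_param {ι : Type*} {l : Filter ι} [l.IsCountablyGenerated] {t : ℝ}
    {G : ι → ℝ → Rn n → Rn n → ℝ} {lam' : ι → ℝ → Rn n → ℝ} {c' : ι → ℝ → ℝ}
    {H : ℝ → Rn n → Rn n → ℝ} {lam : ℝ → Rn n → ℝ} {c : ℝ → ℝ}
    {x : ι → Rn n} {x₀ : Rn n} {a : ι → Rn1 n} {a₀ : Rn1 n}
    (hGconv : ∀ k, ConvexOn ℝ univ (G k t (x k))) (hGcont : ∀ k, Continuous (G k t (x k)))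
    (hHconv : ConvexOn ℝ univ (H t x₀)) (hHcont : Continuous (H t x₀))
    (hG : ∀ R, ∀ ε > 0, ∀ᶠ k in l, ∀ p, ‖p‖ ≤ R → |G k t (x k) p - H t x₀ p| ≤ ε)
    (hlam : Tendsto (fun k => lam' k t (x k)) l (𝓝 (lam t x₀)))
    (hc : Tendsto (fun k => c' k t) l (𝓝 (c t)))
    (hx : Tendsto x l (𝓝 x₀)) (ha : Tendsto a l (𝓝 a₀)) :
    Tendsto (fun k => param (G k) (lam' k) (c' k) t (x k) (a k)) l
      (𝓝 (param H lam c t x₀ a₀)) := by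
  have hG0 : Tendsto (fun k => G k t (x k) 0) l (𝓝 (H t x₀ 0)) := by
    refine Metric.tendsto_nhds.2 fun ε hε => ?_
    filter_upwards [hG 0 (ε / 2) (by positivity)] with k hk
    rw [Real.dist_eq]
    linarith [hk 0 (by simp)]
  have hω : Tendsto (fun k => omega (G k) (lam' k) (c' k) t (x k)) l (𝓝 (omega H lam c t x₀)) :=
    ((hlam.abs.add hG0.abs).add (hc.mul (hx.norm.const_add 1))).add_const 1
  simp only [param, epiSet_lagrangian]
  exact (kuratowskiTendsto_epiConj hGconv hG).tendsto_steinerPoint (convex_epiConj _)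
    (isClosed_epiConj _) (epiConj_nonempty hHconv hHcont) (fun k => isClosed_epiConj _)
    (fun k => epiConj_nonempty (hGconv k) (hGcont k)) (hω.smul ha)

/-! ### Uniform and continuous convergence -/

/-- Continuous convergence on a compact set is uniform. -/
theorem tendstoUniformlyOn_of_tendsto_prod {X Y : Type*} [TopologicalSpace X] [UniformSpace Y]
    {g : ℕ → X → Y} {g₀ : X → Y} {K : Set X} (hK : IsCompact K)
    (h : ∀ x ∈ K, Tendsto (fun q : ℕ × X => g q.1 q.2) (atTop ×ˢ 𝓝[K] x) (𝓝 (g₀ x)))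
    (h₀ : ContinuousOn g₀ K) : TendstoUniformlyOn g g₀ atTop K := by
  rw [← tendstoLocallyUniformlyOn_iff_tendstoUniformlyOn_of_compact hK,
    tendstoLocallyUniformlyOn_iff_filter]
  intro x hx
  rw [tendstoUniformlyOnFilter_iff_tendsto]
  exact (((h₀ x hx).tendsto.comp tendsto_snd).prodMk_nhds (h x hx)).mono_right
    (nhds_le_uniformity _)

/-- A continuous function of two variables varies uniformly on balls in the second one. -/
theorem eventually_abs_sub_le_of_continuous {h : Rn n → Rn n → ℝ}
    (hh : Continuous fun z : Rn n × Rn n => h z.1 z.2) (x₀ : Rn n) (R : ℝ) {ε : ℝ} (hε : 0 < ε) :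
    ∀ᶠ x in 𝓝 x₀, ∀ p, ‖p‖ ≤ R → |h x p - h x₀ p| ≤ ε := by
  obtain ⟨v, hv, hvε⟩ := (isCompact_closedBall (0 : Rn n) R).mem_uniformity_of_prod
    (f := h) (s := univ) (q := x₀) hh.continuousOn (mem_univ _) (Metric.dist_mem_uniformity hε)
  rw [nhdsWithin_univ] at hv
  filter_upwards [hv] with x hx p hp
  exact (hvε x hx p (by simpa using hp)).le

/-- Uniform convergence on compact sets to a continuous limit is continuous convergence. -/
theorem TendstoUnifOnCompacts.tendsto_prod {X Y : Type*} [PseudoMetricSpace X] [ProperSpace X]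
    [PseudoMetricSpace Y] {g : ℕ → X → Y} {g₀ : X → Y} (h : TendstoUnifOnCompacts g g₀ univ)
    (h₀ : Continuous g₀) (x₀ : X) :
    Tendsto (fun q : ℕ × X => g q.1 q.2) (atTop ×ˢ 𝓝 x₀) (𝓝 (g₀ x₀)) := by
  have h1 := (h _ (subset_univ _) (isCompact_closedBall x₀ 1)).tendstoUniformlyOnFilter
  refine (tendsto_iff_of_dist ?_).1 ((h₀.tendsto x₀).comp tendsto_snd)
  have h2 := tendstoUniformlyOnFilter_iff_tendsto.1
    (h1.mono_right (le_principal_iff.2 (Metric.closedBall_mem_nhds x₀ one_pos)))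
  exact tendsto_uniformity_iff_dist_tendsto_zero.1 h2

/-- Compare through `g₀ (x, p)`: uniform convergence on a product of balls controls one half,
continuity of `g₀` the other. -/
theorem TendstoUnifOnCompacts.eventually_abs_sub_le {g : ℕ → Rn n × Rn n → ℝ}
    {g₀ : Rn n × Rn n → ℝ} (h : TendstoUnifOnCompacts g g₀ univ) (h₀ : Continuous g₀)
    (x₀ : Rn n) (R : ℝ) {ε : ℝ} (hε : 0 < ε) :
    ∀ᶠ q : ℕ × Rn n in atTop ×ˢ 𝓝 x₀, ∀ p, ‖p‖ ≤ R → |g q.1 (q.2, p) - g₀ (x₀, p)| ≤ ε := by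
  have h1 := Metric.tendstoUniformlyOn_iff.1 (h _ (subset_univ _)
    ((isCompact_closedBall x₀ 1).prod (isCompact_closedBall (0 : Rn n) R))) (ε / 2) (by positivity)
  have h2 := eventually_abs_sub_le_of_continuous (h := fun x p => g₀ (x, p)) h₀ x₀ R
    (ε := ε / 2) (by positivity)
  filter_upwards [h1.prod_mk (h2.and (Metric.closedBall_mem_nhds x₀ one_pos))] with q hq p hp
  have h3 := hq.1 (q.2, p) ⟨hq.2.2, by simpa using hp⟩
  have h4 := hq.2.1 p hp
  rw [dist_comm, Real.dist_eq] at h3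
  have h5 := abs_sub_le (g q.1 (q.2, p)) (g₀ (q.2, p)) (g₀ (x₀, p))
  linarith

end HJRep

theorem theorem3p5 (n : ℕ) (T : ℝ)
    (Hi : ℕ → ℝ → HJRep.Rn n → HJRep.Rn n → ℝ) (H : ℝ → HJRep.Rn n → HJRep.Rn n → ℝ)
    (lami : ℕ → ℝ → HJRep.Rn n → ℝ) (lam : ℝ → HJRep.Rn n → ℝ)
    (ci : ℕ → ℝ → ℝ) (c : ℝ → ℝ)
    (hHi : ∀ i, HJRep.SatisfiesH T (Hi i) (ci i)) (hH : HJRep.SatisfiesH T H c)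
    (hHLCi : ∀ i, HJRep.SatisfiesHLC T (Hi i)) (hHLC : HJRep.SatisfiesHLC T H)
    (hBLCi : ∀ i, HJRep.SatisfiesBLC T (HJRep.lagrangian (Hi i)) (lami i))
    (hBLC : HJRep.SatisfiesBLC T (HJRep.lagrangian H) lam)
    (hHconv : ∀ t ∈ Set.Icc 0 T, HJRep.TendstoUnifOnCompacts
      (fun i (z : HJRep.Rn n × HJRep.Rn n) => Hi i t z.1 z.2) (fun z => H t z.1 z.2) Set.univ)
    (hlamconv : ∀ t ∈ Set.Icc 0 T,
      HJRep.TendstoUnifOnCompacts (fun i => lami i t) (lam t) Set.univ)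
    (hcconv : ∀ t ∈ Set.Icc 0 T,
      Filter.Tendsto (fun i => ci i t) Filter.atTop (nhds (c t))) :
    ∀ t ∈ Set.Icc 0 T,
      HJRep.TendstoUnifOnCompacts
        (fun i (z : HJRep.Rn n × HJRep.Rn1 n) => HJRep.repF (Hi i) (lami i) (ci i) t z.1 z.2)
        (fun z => HJRep.repF H lam c t z.1 z.2)
        (Set.univ ×ˢ Metric.closedBall (0 : HJRep.Rn1 n) 1) ∧
      HJRep.TendstoUnifOnCompacts
        (fun i (z : HJRep.Rn n × HJRep.Rn1 n) => HJRep.repL (Hi i) (lami i) (ci i) t z.1 z.2)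
        (fun z => HJRep.repL H lam c t z.1 z.2)
        (Set.univ ×ˢ Metric.closedBall (0 : HJRep.Rn1 n) 1) := by
  intro t ht
  have hcont : ∀ {G : ℝ → HJRep.Rn n → HJRep.Rn n → ℝ} {c' : ℝ → ℝ}, HJRep.SatisfiesH T G c' →
      ∀ x, Continuous (G t x) := fun hG x => (hG.h2 t ht).comp (Continuous.prodMk_right x)
  have hparam : Continuous fun z : HJRep.Rn n × HJRep.Rn1 n => HJRep.param H lam c t z.1 z.2 := by
    refine continuous_iff_continuousAt.2 fun z₀ => ?_
    refine HJRep.tendsto_param (G := fun _ => H) (lam' := fun _ => lam) (c' := fun _ => c)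
      (fun z => hH.h3 t ht _) (fun z => hcont hH _) (hH.h3 t ht _) (hcont hH _) (fun R ε hε => ?_)
      (((hBLC.continuous t ht).comp continuous_fst).tendsto z₀) tendsto_const_nhds
      (continuous_fst.tendsto z₀) (continuous_snd.tendsto z₀)
    exact (continuous_fst.tendsto z₀).eventually
      (HJRep.eventually_abs_sub_le_of_continuous (hH.h2 t ht) z₀.1 R hε)
  have hlim : ∀ (K : Set (HJRep.Rn n × HJRep.Rn1 n)) (z₀ : HJRep.Rn n × HJRep.Rn1 n),
      Tendsto (fun q : ℕ × HJRep.Rn n × HJRep.Rn1 n =>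
        HJRep.param (Hi q.1) (lami q.1) (ci q.1) t q.2.1 q.2.2) (atTop ×ˢ 𝓝[K] z₀)
        (𝓝 (HJRep.param H lam c t z₀.1 z₀.2)) := by
    intro K z₀
    have hz : Tendsto (fun q : ℕ × HJRep.Rn n × HJRep.Rn1 n => q.2) (atTop ×ˢ 𝓝[K] z₀) (𝓝 z₀) :=
      tendsto_snd.mono_right nhdsWithin_le_nhds
    have hx : Tendsto (fun q : ℕ × HJRep.Rn n × HJRep.Rn1 n => q.2.1) (atTop ×ˢ 𝓝[K] z₀)
        (𝓝 z₀.1) := (continuous_fst.tendsto z₀).comp hz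
    have ha : Tendsto (fun q : ℕ × HJRep.Rn n × HJRep.Rn1 n => q.2.2) (atTop ×ˢ 𝓝[K] z₀)
        (𝓝 z₀.2) := (continuous_snd.tendsto z₀).comp hz
    have hq : Tendsto (fun q : ℕ × HJRep.Rn n × HJRep.Rn1 n => (q.1, q.2.1)) (atTop ×ˢ 𝓝[K] z₀)
        (atTop ×ˢ 𝓝 z₀.1) := tendsto_fst.prodMk hx
    have hH' : ∀ R, ∀ ε > 0, ∀ᶠ q : ℕ × HJRep.Rn n × HJRep.Rn1 n in atTop ×ˢ 𝓝[K] z₀,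
        ∀ p, ‖p‖ ≤ R → |Hi q.1 t q.2.1 p - H t z₀.1 p| ≤ ε := fun R ε hε =>
      hq.eventually ((hHconv t ht).eventually_abs_sub_le (hH.h2 t ht) z₀.1 R hε)
    have hlam' : Tendsto (fun q : ℕ × HJRep.Rn n × HJRep.Rn1 n => lami q.1 t q.2.1)
        (atTop ×ˢ 𝓝[K] z₀) (𝓝 (lam t z₀.1)) :=
      ((hlamconv t ht).tendsto_prod (hBLC.continuous t ht) z₀.1).comp hq
    have hc' : Tendsto (fun q : ℕ × HJRep.Rn n × HJRep.Rn1 n => ci q.1 t)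
        (atTop ×ˢ 𝓝[K] z₀) (𝓝 (c t)) := (hcconv t ht).comp tendsto_fst
    have hcv := fun q : ℕ × HJRep.Rn n × HJRep.Rn1 n => (hHi q.1).h3 t ht q.2.1
    have hct := fun q : ℕ × HJRep.Rn n × HJRep.Rn1 n => hcont (hHi q.1) q.2.1
    have key := @HJRep.tendsto_param n (ℕ × HJRep.Rn n × HJRep.Rn1 n) (atTop ×ˢ 𝓝[K] z₀)
      inferInstance t (fun q => Hi q.1) (fun q => lami q.1) (fun q => ci q.1) H lam c (fun q => q.2.1) z₀.1
      (fun q => q.2.2) z₀.2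
    exact key hcv hct (hH.h3 t ht z₀.1) (hcont hH z₀.1) hH' hlam' hc' hx ha
  refine ⟨fun K _ hK => ?_, fun K _ hK => ?_⟩
  · refine HJRep.tendstoUniformlyOn_of_tendsto_prod hK (fun z _ => ?_) ?_
    · have := (HJRep.continuous_fst_Rn1.tendsto (HJRep.param H lam c t z.1 z.2)).comp (hlim K z)
      exact this
    · have := HJRep.continuous_fst_Rn1.comp hparam
      exact this.continuousOn
  · refine HJRep.tendstoUniformlyOn_of_tendsto_prod hK (fun z _ => ?_) ?_
    · have := (HJRep.continuous_snd_Rn1.tendsto (HJRep.param H lam c t z.1 z.2)).comp (hlim K z)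
      exact this
    · have := HJRep.continuous_snd_Rn1.comp hparam
      exact this.continuousOn
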